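/- **Model.** Let $n=L\,n_I$ and $0\le k<n$. A clustered distributed storage system $\mathcal D(n,k)$ has $n$ active storage nodes, $n_I$ in each of $L$ clusters. Data amounts are measured in symbols of an alphabet of some size $q\ge 2$, which each coding scheme may choose. Each node stores at most $\alpha\ge 0$ symbols, i.e. its content takes at most $q^{\alpha}$ values. A source holds a file $F$, a random variable on a finite probability space. From $F$ and possibly further randomness it computes the initial contents of the nodes. Nodes fail one at a time. Each failed node is replaced, before the next failure, by a newcomer in the same cluster. Each of the other $d=n-1$ active nodes sends the newcomer a packet of at most $\beta=\gamma/d$ symbols ($\gamma\ge 0$), i.e. one of at most $q^{\beta}$ values. The packet is a function of the helper's content, and the newcomer's content is a function of the $n-1$ packets; these functions may depend on the nodes involved and on the history of failures. A scheme is *reliable* if after every finite sequence of failures the file can be recovered with probability one from the contents of any $k$ active nodes. A *node-restricted eavesdropper* with $L_c\le L$ compromised clusters chooses any $L_c$ clusters. In every repair it reads exactly the packets sent between two different clusters of which at least one is compromised; it does not see the contents of nodes. A scheme is *perfectly secret* if, for every choice of the $L_c$ clusters and every finite sequence of failures, everything that the eavesdropper reads is independent of $F$. The *secrecy capacity* $C_s(\alpha,\gamma)$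 is the supremum of $H(F)$, the Shannon entropy of $F$ to base $q$, over all reliable and perfectly secret schemes (over all $q$). **Theorem 1.** With $\beta=\gamma/(n-1)$, $$C_s(\alpha,\gamma)\le\begin{cases}\displaystyle L_c\sum_{i=1}^{n_I}\min\{(n_I-i)\beta,\alpha\}+\sum_{i=n_IL_c+1}^{k}\min\{(n-i)\beta,\alpha\}, & n_IL_c<k,\\[2ex] \displaystyle\lfloor k/n_I\rfloor\sum_{i=1}^{n_I}\min\{(n_I-i)\beta,\alpha\}+\sum_{i=1}^{k\bmod n_I}\min\{(n_I-i)\beta,\alpha\}, & \text{otherwise.}\end{cases}$$ (In the trivial case $n=1$, $k=0$, read $\beta=0$.) -/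

import Mathlib

namespace ClusteredDSS

/-- The places of the active storage nodes: `(c, j)` is the `j`-th place of cluster `c`. A newcomer
takes the place (hence the cluster) of the failed node that it replaces, so at any time there is
exactly one active node at every place. There are `n = L * nI` places. -/
abbrev Node (L nI : ℕ) : Type := Fin L × Fin nI

/-- A failure history, with the most recent failure at the head: the places whose active nodes have
failed, one after the other, each being repaired before the next failure. -/
abbrev History (L nI : ℕ) : Type := List (Node L nI)

/-- A coding scheme for a clustered distributed storage system with `L` clusters of `nI` nodes
each, in which every repair uses all `d = n - 1` other active nodes as helpers. Amounts of data are
measured in symbols of an alphabet of size `q`. -/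
structure Scheme (L nI : ℕ) where
  /-- size of the symbol alphabet that serves as the unit of information -/
  q : ℕ
  two_le_q : 2 ≤ q
  /-- the randomness of the source: the file together with any secret key of the encoder -/
  Source : Type
  [fintypeSource : Fintype Source]
  /-- the probability law of the source -/
  law : PMF Source
  /-- the possible files -/
  File : Type
  [fintypeFile : Fintype File]
  /-- the file to be stored -/
  file : Source → File
  /-- the possible contents of a storage node -/
  Content : Type
  [fintypeContent : Fintype Content]
  /-- the possible packets that one helper sends in one repair -/
  Packet : Type
  [fintypePacket : Fintype Packet]
  /-- what the source initially stores at each place -/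
  encode : Node L nI → Source → Content
  /-- `send h f u x`: after the history `h`, when the node at `f` fails, the packet that the
  helper at `u` with content `x` sends to the newcomer at `f` -/
  send : History L nI → Node L nI → Node L nI → Content → Packet
  /-- `restore h f p`: after the history `h`, when the node at `f` fails, what the newcomer
  at `f` stores if it receives the packets `p` from all the other nodes -/
  restore : History L nI → (f : Node L nI) → ({u : Node L nI // u ≠ f} → Packet) → Content

attribute [instance] Scheme.fintypeSource Scheme.fintypeFile Scheme.fintypeContent
  Scheme.fintypePacket

namespace Scheme

variable {L nI : ℕ} (C : Scheme L nI)

/-- The content of the active node at each place after a failure history. -/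
def content : History L nI → C.Source → Node L nI → C.Content
  | [], ω, v => C.encode v ω
  | f :: h, ω, v =>
      if v = f then C.restore h f (fun u => C.send h f u (content h ω u)) else content h ω v

/-- The packet sent by the helper at `u` to the newcomer at `f`, in the repair of `f` that follows
the history `h`. -/
def packet (h : History L nI) (f u : Node L nI) (ω : C.Source) : C.Packet :=
  C.send h f u (C.content h ω u)

/-- What a node-restricted eavesdropper who compromises the clusters in `K` reads during a failure
history: for every repair, exactly those packets that pass between two different clusters and enter
or leave a cluster in `K`. -/
def observation (K : Finset (Fin L)) :
    History L nI → C.Source → List (Node L nI → Option C.Packet)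
  | [], _ => []
  | f :: h, ω =>
      (fun u => if u.1 ≠ f.1 ∧ (u.1 ∈ K ∨ f.1 ∈ K) then some (C.packet h f u ω) else none)
        :: observation K h ω

/-- A node stores at most `α` symbols and a helper sends at most `β` symbols in a repair. -/
def FitsIn (α β : ℝ) : Prop :=
  (Fintype.card C.Content : ℝ) ≤ (C.q : ℝ) ^ α ∧ (Fintype.card C.Packet : ℝ) ≤ (C.q : ℝ) ^ β

/-- After every failure history, a data collector that contacts any `k` active nodes recovers the
file (for every outcome of positive probability). -/
def Reliable (k : ℕ) : Prop :=
  ∀ (h : History L nI) (A : Finset (Node L nI)), A.card = k →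
    ∃ decode : (A → C.Content) → C.File,
      ∀ ω ∈ C.law.support, decode (fun v => C.content h ω v) = C.file ω

/-- Perfect secrecy: whatever `Lc` clusters are compromised and whatever the failure history is,
the observation of the eavesdropper is independent of the file. -/
def PerfectlySecret (Lc : ℕ) : Prop :=
  ∀ (h : History L nI) (K : Finset (Fin L)), K.card = Lc →
    ∀ (m : C.File) (e : List (Node L nI → Option C.Packet)),
      C.law.map (fun ω => (C.file ω, C.observation K h ω)) (m, e)
        = C.law.map C.file m * C.law.map (C.observation K h) e

/-- The amount of stored information: the Shannon entropy of the file, in symbols (that is, with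
logarithms to base `q`). -/
noncomputable def rate : ℝ :=
  (∑ m : C.File, Real.negMulLog (C.law.map C.file m).toReal) / Real.log C.q

end Scheme

/-- The secrecy capacity `C_s(α, γ)` of the clustered system with `L` clusters of `nI` nodes, `k`
nodes contacted by a data collector, node size `α` and total repair bandwidth `γ` shared equally by
`d = n - 1` helpers, against the node-restricted eavesdropper with `Lc` compromised clusters: the
supremum of the amounts of information that can be stored reliably and with perfect secrecy. -/
noncomputable def secrecyCapacity (L nI k Lc : ℕ) (α γ : ℝ) : EReal :=
  sSup {R : EReal | ∃ C : Scheme L nI,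
    C.FitsIn α (γ / ((L * nI : ℕ) - 1 : ℝ)) ∧ C.Reliable k ∧ C.PerfectlySecret Lc ∧
      R = (C.rate : EReal)}

end ClusteredDSS

/-! One history and one choice of clusters suffice. Number the nodes cluster by cluster, let nodes
`0, …, k - 1` fail in this order, and compromise the first `Lc` clusters. By secrecy the file F is
independent of the observation E, and the k newcomers determine F, so H(F) + H(E) = H(F, E) ≤ H(E,
contents). It remains to bound H(contents | E) repair by repair. A newcomer adds at most α symbols,
and at most β per helper that is neither an earlier newcomer nor overheard
(`entropy_observation_contents_le`). In a compromised cluster only the later nodes of that cluster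
are such helpers; elsewhere all later nodes may be (`historyCost_firstNodes_le`). -/

namespace ClusteredDSS

/-! ### Entropy on a finite probability space -/

section Entropy

open Classical in
/-- The total weight of the outcomes at which `X` takes the value `s`. -/
noncomputable def mass {Ω S : Type*} [Fintype Ω] (w : Ω → ℝ) (X : Ω → S) (s : S) : ℝ :=
  ∑ ω with X ω = s, w ω

/-- The Shannon entropy, in nats, of a function on a finite probability space. The codomain may be
infinite. -/
noncomputable def entropy {Ω S : Type*} [Fintype Ω] (w : Ω → ℝ) (X : Ω → S) : ℝ :=
  ∑ ω, w ω * -Real.log (mass w X (X ω))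

variable {Ω S T : Type*} [Fintype Ω] {w : Ω → ℝ}

theorem mass_pos (hw : ∀ ω, 0 ≤ w ω) (X : Ω → S) {ω : Ω} (h : 0 < w ω) : 0 < mass w X (X ω) := by
  classical
  exact h.trans_le (Finset.single_le_sum (f := w) (fun i _ => hw i) (by simp))

/-- Up to null outcomes, each fibre of `X` lies in a fibre of `Y`, so the masses compare pointwise.
-/
theorem entropy_le_of_determines (hw : ∀ ω, 0 ≤ w ω) {X : Ω → S} {Y : Ω → T}
    (h : ∀ ω ω', 0 < w ω → 0 < w ω' → X ω = X ω' → Y ω = Y ω') : entropy w Y ≤ entropy w X := by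
  classical
  refine Finset.sum_le_sum fun ω _ => ?_
  rcases (hw ω).eq_or_lt with h0 | h0
  · simp [← h0]
  refine mul_le_mul_of_nonneg_left (neg_le_neg (Real.log_le_log (mass_pos hw X h0) ?_)) h0.le
  unfold mass
  rw [Finset.sum_filter, Finset.sum_filter]
  refine Finset.sum_le_sum fun ω' _ => ?_
  rcases (hw ω').eq_or_lt with h1 | h1
  · simp [← h1]
  by_cases hX : X ω' = X ω
  · simp [hX, h ω' ω h1 h0 hX]
  · rw [if_neg hX]
    split_ifs
    exacts [h1.le, le_rfl]

/-- Pairing with a variable of `c` possible values raises the entropy by at most `log c`. -/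
theorem entropy_prod_le [Fintype T] (hw : ∀ ω, 0 ≤ w ω) (h1 : ∑ ω, w ω = 1) (Z : Ω → S)
    (Y : Ω → T) :
    entropy w (fun ω => (Z ω, Y ω)) ≤ entropy w Z + Real.log (Fintype.card T) := by
  classical
  set c : ℝ := (Fintype.card T : ℝ)
  have hne : Nonempty Ω := by
    by_contra h
    rw [not_nonempty_iff] at h
    simp at h1
  have hc0 : 0 < c := by
    have : Nonempty T := hne.map Y
    exact Nat.cast_pos.2 Fintype.card_pos
  set V : Ω → S × T := fun ω => (Z ω, Y ω) with hV
  -- This is the mean of 1 / P(Y | Z): each pair (z, t) contributes at most the mass of z, and there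
  -- are c values of t.
  have hsum : ∑ ω, w ω * (mass w Z (Z ω) / mass w V (V ω)) ≤ c := by
    have hmaps : ∀ ω ∈ (Finset.univ : Finset Ω),
        V ω ∈ Finset.univ.image Z ×ˢ (Finset.univ : Finset T) := by
      intro ω _
      simp [hV]
    rw [← Finset.sum_fiberwise_of_maps_to hmaps]
    calc _ ≤ ∑ b ∈ Finset.univ.image Z ×ˢ (Finset.univ : Finset T), mass w Z b.1 := by
          refine Finset.sum_le_sum fun b _ => ?_
          have hfib : ∑ ω with V ω = b, w ω * (mass w Z (Z ω) / mass w V (V ω))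
              = mass w V b * (mass w Z b.1 / mass w V b) := by
            have hm : mass w V b = ∑ ω with V ω = b, w ω := by
              unfold mass
              congr
            nth_rw 1 [hm]
            rw [Finset.sum_mul]
            refine Finset.sum_congr rfl fun ω hω => ?_
            rw [← (Finset.mem_filter.1 hω).2]
          rw [hfib]
          have hnn : 0 ≤ mass w Z b.1 := Finset.sum_nonneg fun i _ => hw i
          by_cases h0 : mass w V b = 0
          · simpa [h0] using hnn
          · rw [mul_div_cancel₀ _ h0]
      _ = c := by
          rw [Finset.sum_product]
          simp only [Finset.sum_const, Finset.card_univ, nsmul_eq_mul]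
          rw [← Finset.mul_sum]
          have : ∑ z ∈ Finset.univ.image Z, mass w Z z = 1 := by
            rw [← h1]
            exact Finset.sum_fiberwise_of_maps_to (fun ω _ => by simp) _
          rw [this, mul_one]
  -- Jensen's inequality in the form log x ≤ x - 1, with x = 1 / (c P(Y | Z)).
  have hpt : ∀ ω, w ω * -Real.log (mass w V (V ω)) ≤ w ω * -Real.log (mass w Z (Z ω))
      + w ω * (Real.log c - 1) + w ω * (mass w Z (Z ω) / mass w V (V ω)) / c := by
    intro ω
    rcases (hw ω).eq_or_lt with h0 | h0
    · simp [← h0]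
    have hz := mass_pos hw Z h0
    have hv := mass_pos hw V h0
    have hlog := Real.log_le_sub_one_of_pos (div_pos (div_pos hz hv) hc0)
    rw [Real.log_div (div_pos hz hv).ne' hc0.ne', Real.log_div hz.ne' hv.ne'] at hlog
    rw [mul_div_assoc, ← mul_add, ← mul_add]
    exact mul_le_mul_of_nonneg_left (by linarith) h0.le
  have := Finset.sum_le_sum fun ω (_ : ω ∈ Finset.univ) => hpt ω
  rw [Finset.sum_add_distrib, Finset.sum_add_distrib, ← Finset.sum_mul, h1, ← Finset.sum_div]
    at this
  have h2 := (div_le_one hc0).2 hsum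
  unfold entropy
  linarith

theorem entropy_prod_of_indep (hw : ∀ ω, 0 ≤ w ω) {X : Ω → S} {Y : Ω → T}
    (h : ∀ s t, mass w (fun ω => (X ω, Y ω)) (s, t) = mass w X s * mass w Y t) :
    entropy w (fun ω => (X ω, Y ω)) = entropy w X + entropy w Y := by
  unfold entropy
  rw [← Finset.sum_add_distrib]
  refine Finset.sum_congr rfl fun ω _ => ?_
  rcases (hw ω).eq_or_lt with h0 | h0
  · simp [← h0]
  rw [h, Real.log_mul (mass_pos hw X h0).ne' (mass_pos hw Y h0).ne']
  ring

theorem entropy_eq_sum_negMulLog [Fintype S] (X : Ω → S) :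
    entropy w X = ∑ s, Real.negMulLog (mass w X s) := by
  classical
  unfold entropy
  rw [← Finset.sum_fiberwise_of_maps_to (fun ω _ => Finset.mem_univ (X ω))]
  refine Finset.sum_congr rfl fun s _ => ?_
  rw [Real.negMulLog, neg_mul_comm]
  conv_rhs => rw [mass, Finset.sum_mul]
  exact Finset.sum_congr rfl fun ω hω => by rw [(Finset.mem_filter.1 hω).2]; rfl

theorem toReal_map_apply (p : PMF Ω) (X : Ω → S) (s : S) :
    (p.map X s).toReal = mass (fun ω => (p ω).toReal) X s := by
  classical
  rw [PMF.map_apply, tsum_fintype, ENNReal.toReal_sum, mass, Finset.sum_filter]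
  · refine Finset.sum_congr rfl fun ω _ => ?_
    by_cases h : X ω = s
    · simp [h]
    · simp [h, Ne.symm h]
  · intro ω _
    split_ifs
    exacts [p.apply_ne_top ω, ENNReal.zero_ne_top]

theorem sum_toReal_eq_one (p : PMF Ω) : ∑ ω, (p ω).toReal = 1 := by
  rw [← ENNReal.toReal_sum fun ω _ => p.apply_ne_top ω, ← tsum_fintype (L := .unconditional _),
    p.tsum_coe, ENNReal.toReal_one]

end Entropy

/-! ### Entropy cost of a failure history -/

/-- The helpers of the newcomer at `f` outside the list `t` whose packets are not read by an
eavesdropper who compromises the clusters in `K`. -/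
def unknownHelpers {L nI : ℕ} (K : Finset (Fin L)) (f : Node L nI) (t : History L nI) :
    Finset (Node L nI) :=
  {u | u ≠ f ∧ u ∉ t ∧ ¬(u.1 ≠ f.1 ∧ (u.1 ∈ K ∨ f.1 ∈ K))}

/-- A bound for the conditional entropy, in symbols, of the contents of the nodes that were
repaired during a history, given the observation of the eavesdropper. -/
noncomputable def historyCost {L nI : ℕ} (K : Finset (Fin L)) (α β : ℝ) : History L nI → ℝ
  | [] => 0
  | f :: t => historyCost K α β t + min ((unknownHelpers K f t).card * β) α

namespace Scheme

variable {L nI : ℕ} (C : Scheme L nI)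

theorem content_append {s t : History L nI} {v : Node L nI} (hv : v ∉ s) (ω : C.Source) :
    C.content (s ++ t) ω v = C.content t ω v := by
  induction s with
  | nil => rfl
  | cons f s ih =>
    rw [List.mem_cons, not_or] at hv
    rw [List.cons_append, content, if_neg hv.1, ih hv.2]

theorem observation_eq_of_append {K : Finset (Fin L)} {s t : History L nI} {ω ω' : C.Source}
    (h : C.observation K (s ++ t) ω = C.observation K (s ++ t) ω') :
    C.observation K t ω = C.observation K t ω' := by
  induction s with
  | nil => exact h
  | cons f s ih => exact ih (List.cons.inj h).2

theorem packet_eq_of_observation_eq {K : Finset (Fin L)} {t : History L nI} {f u : Node L nI}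
    {ω ω' : C.Source} (h : C.observation K (f :: t) ω = C.observation K (f :: t) ω')
    (hu : u.1 ≠ f.1 ∧ (u.1 ∈ K ∨ f.1 ∈ K)) : C.packet t f u ω = C.packet t f u ω' := by
  have := congrFun (List.cons.inj h).1 u
  simpa only [if_pos hu, Option.some.injEq] using this

/-- The observation, the contents of the nodes repaired earlier and the packets of the unknown
helpers determine the content of a newcomer. -/
theorem content_eq_of_observation_eq {K : Finset (Fin L)} {s t : History L nI} {f : Node L nI}
    (hnd : (s ++ f :: t).Nodup) {ω ω' : C.Source}
    (hobs : C.observation K (s ++ f :: t) ω = C.observation K (s ++ f :: t) ω')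
    (ht : ∀ v ∈ t, C.content (s ++ f :: t) ω v = C.content (s ++ f :: t) ω' v)
    (hM : ∀ u ∈ unknownHelpers K f t, C.packet t f u ω = C.packet t f u ω') :
    C.content (s ++ f :: t) ω f = C.content (s ++ f :: t) ω' f := by
  have hdisj := (List.nodup_append'.1 hnd).2.2
  have hfs : f ∉ s := fun h => hdisj h (by simp)
  rw [C.content_append hfs, C.content_append hfs, content, content, if_pos rfl, if_pos rfl]
  congr 1
  funext ⟨u, huf⟩
  change C.packet t f u ω = C.packet t f u ω'
  -- A helper in `t` does not fail again, since the history has no repetitions; its final content is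
  -- the one from which it sent its packet.
  by_cases hut : u ∈ t
  · have hus : u ∉ s ++ [f] := by
      rw [List.mem_append, List.mem_singleton, not_or]
      exact ⟨fun h => hdisj h (by simp [hut]), huf⟩
    have := ht u hut
    rw [List.append_cons, C.content_append hus, C.content_append hus] at this
    rw [packet, packet, this]
  by_cases hc : u.1 ≠ f.1 ∧ (u.1 ∈ K ∨ f.1 ∈ K)
  · exact C.packet_eq_of_observation_eq (C.observation_eq_of_append hobs) hc
  · exact hM u (by simp only [unknownHelpers, Finset.mem_filter_univ]; exact ⟨huf, hut, hc⟩)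

/-- The probability of an outcome of the source. -/
noncomputable def weight (ω : C.Source) : ℝ := (C.law ω).toReal

theorem weight_nonneg (ω : C.Source) : 0 ≤ C.weight ω := ENNReal.toReal_nonneg

theorem log_q_pos : 0 < Real.log C.q :=
  Real.log_pos (by exact_mod_cast C.two_le_q)

theorem mem_support_of_weight_pos {ω : C.Source} (h : 0 < C.weight ω) : ω ∈ C.law.support := by
  rw [PMF.mem_support_iff]
  intro h0
  simp [weight, h0] at h

/-- One repair raises the entropy of what is known by at most its term in `historyCost`. -/
theorem entropy_observation_contents_le {α β : ℝ} (hfit : C.FitsIn α β) (hα : 0 ≤ α) (hβ : 0 ≤ β)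
    (K : Finset (Fin L)) (h : History L nI) (hnd : h.Nodup) (s t : History L nI)
    (hst : h = s ++ t) :
    entropy C.weight (fun ω => (C.observation K h ω, t.map (C.content h ω)))
      ≤ entropy C.weight (C.observation K h) + historyCost K α β t * Real.log C.q := by
  have hw := C.weight_nonneg
  have h1 : ∑ ω, C.weight ω = 1 := sum_toReal_eq_one C.law
  have hq : (0 : ℝ) < C.q := by exact_mod_cast two_pos.trans_le C.two_le_q
  have hlog {c : ℕ} {x : ℝ} (hx : 0 ≤ x) (hc : (c : ℝ) ≤ (C.q : ℝ) ^ x) :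
      Real.log c ≤ x * Real.log C.q := by
    -- An empty alphabet has `Real.log 0 = 0`, so this case needs `0 ≤ x`.
    rcases c.eq_zero_or_pos with rfl | h0
    · simpa using mul_nonneg hx C.log_q_pos.le
    · rw [← Real.log_rpow hq]
      exact Real.log_le_log (by exact_mod_cast h0) hc
  -- The whole history `h` stays fixed, so observation and contents are those at its end; only the
  -- suffix `t` of oldest repairs grows.
  induction t generalizing s with
  | nil =>
    simp only [historyCost, zero_mul, add_zero]
    exact entropy_le_of_determines hw fun ω ω' _ _ h => by simp [h]
  | cons f t ih =>
    specialize ih (s ++ [f]) (by simpa using hst)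
    set Z := fun ω => (C.observation K h ω, t.map (C.content h ω))
    -- Used twice: with `Y` the new content itself, giving α, and with `Y` the packets of the
    -- unknown helpers, giving β for each.
    have hstep (T : Type) [Fintype T] (Y : C.Source → T)
        (hY : ∀ ω ω', Z ω = Z ω' → Y ω = Y ω' → C.content h ω f = C.content h ω' f) :
        entropy C.weight (fun ω => (C.observation K h ω, (f :: t).map (C.content h ω)))
          ≤ entropy C.weight Z + Real.log (Fintype.card T) := by
      refine (entropy_le_of_determines hw fun ω ω' _ _ he => ?_).trans
        (entropy_prod_le hw h1 Z Y)
      obtain ⟨hz, hy⟩ := Prod.mk.inj he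
      obtain ⟨ho, hc⟩ := Prod.mk.inj hz
      rw [List.map_cons, List.map_cons, ho, hc, hY ω ω' hz hy]
    have hα' : entropy C.weight (fun ω => (C.observation K h ω, (f :: t).map (C.content h ω)))
        ≤ entropy C.weight Z + α * Real.log C.q :=
      (hstep C.Content (fun ω => C.content h ω f) fun _ _ _ hy => hy).trans
        (by gcongr; exact hlog hα hfit.1)
    have hβ' : entropy C.weight (fun ω => (C.observation K h ω, (f :: t).map (C.content h ω)))
        ≤ entropy C.weight Z + ((unknownHelpers K f t).card * β) * Real.log C.q := by
      refine (hstep (unknownHelpers K f t → C.Packet) (fun ω u => C.packet t f u ω)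
        fun ω ω' hz hy => ?_).trans ?_
      · obtain ⟨ho, hc⟩ := Prod.mk.inj hz
        subst hst
        exact C.content_eq_of_observation_eq hnd ho (List.map_inj_left.1 hc)
          fun u hu => congrFun hy ⟨u, hu⟩
      · rw [Fintype.card_fun, Fintype.card_coe, Nat.cast_pow, Real.log_pow, mul_assoc]
        gcongr
        exact hlog hβ hfit.2
    rw [historyCost, add_mul, ← add_assoc]
    rcases min_choice ((unknownHelpers K f t).card * β) α with hm | hm <;> rw [hm] <;> linarith

/-- Secrecy makes H(E) additive on the left, reliability puts the file below the contents, and H(E)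
cancels. -/
theorem rate_le_historyCost {α β : ℝ} (hfit : C.FitsIn α β) (hα : 0 ≤ α) (hβ : 0 ≤ β)
    {k Lc : ℕ} (hrel : C.Reliable k) (hsec : C.PerfectlySecret Lc) {K : Finset (Fin L)}
    (hK : K.card = Lc) {h : History L nI} (hnd : h.Nodup) (hk : h.length = k) :
    C.rate ≤ historyCost K α β h := by
  have hw := C.weight_nonneg
  rw [rate, div_le_iff₀ C.log_q_pos]
  have hrate : ∑ m, Real.negMulLog (C.law.map C.file m).toReal = entropy C.weight C.file := by
    rw [entropy_eq_sum_negMulLog]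
    exact Finset.sum_congr rfl fun m _ => by rw [toReal_map_apply]; rfl
  have hind : entropy C.weight (fun ω => (C.file ω, C.observation K h ω))
      = entropy C.weight C.file + entropy C.weight (C.observation K h) := by
    refine entropy_prod_of_indep hw fun m e => ?_
    have := congrArg ENNReal.toReal (hsec h K hK m e)
    rw [ENNReal.toReal_mul, toReal_map_apply, toReal_map_apply, toReal_map_apply] at this
    exact this
  have hdec : entropy C.weight (fun ω => (C.file ω, C.observation K h ω))
      ≤ entropy C.weight (fun ω => (C.observation K h ω, h.map (C.content h ω))) := by
    obtain ⟨decode, hd⟩ := hrel h h.toFinset (by rw [List.toFinset_card_of_nodup hnd, hk])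
    refine entropy_le_of_determines hw fun ω ω' hω hω' he => ?_
    obtain ⟨ho, hc⟩ := Prod.mk.inj he
    rw [← hd ω (C.mem_support_of_weight_pos hω), ← hd ω' (C.mem_support_of_weight_pos hω'), ho]
    congr 2
    funext v
    exact List.map_inj_left.1 hc v (List.mem_toFinset.1 v.2)
  have := C.entropy_observation_contents_le hfit hα hβ K h hnd [] h rfl
  linarith

end Scheme

/-! ### Counting unknown helpers in the cluster-by-cluster order -/

section Order

variable {L nI : ℕ}

/-- The nodes with the numbers below `k`, in decreasing order, cluster by cluster. -/
def firstNodes (L nI : ℕ) : (k : ℕ) → k ≤ L * nI → History L nI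
  | 0, _ => []
  | k + 1, hk => finProdFinEquiv.symm ⟨k, hk⟩ :: firstNodes L nI k (by omega)

theorem length_firstNodes (k : ℕ) (hk : k ≤ L * nI) : (firstNodes L nI k hk).length = k := by
  induction k with
  | zero => rfl
  | succ k ih => rw [firstNodes, List.length_cons, ih]

theorem mem_firstNodes {k : ℕ} {hk : k ≤ L * nI} {u : Node L nI} :
    u ∈ firstNodes L nI k hk ↔ (finProdFinEquiv u : ℕ) < k := by
  induction k with
  | zero => simp [firstNodes]
  | succ k ih =>
    rw [firstNodes, List.mem_cons, ih, Equiv.eq_symm_apply, Fin.ext_iff]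
    simp only
    omega

theorem nodup_firstNodes (k : ℕ) (hk : k ≤ L * nI) : (firstNodes L nI k hk).Nodup := by
  induction k with
  | zero => exact List.nodup_nil
  | succ k ih =>
    rw [firstNodes, List.nodup_cons]
    refine ⟨?_, ih _⟩
    rw [mem_firstNodes, Equiv.apply_symm_apply]
    exact lt_irrefl k

theorem lt_of_mem_unknownHelpers {K : Finset (Fin L)} {i : ℕ} (hi : i < L * nI) {u : Node L nI}
    (hu : u ∈ unknownHelpers K (finProdFinEquiv.symm ⟨i, hi⟩) (firstNodes L nI i hi.le)) :
    i < (finProdFinEquiv u : ℕ) := by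
  simp only [unknownHelpers, Finset.mem_filter_univ] at hu
  have h1 := hu.1
  have h2 := hu.2.1
  rw [ne_eq, Equiv.eq_symm_apply, Fin.ext_iff] at h1
  rw [mem_firstNodes] at h2
  simp only at h1
  omega

theorem card_unknownHelpers_le_of_forall_lt {K : Finset (Fin L)} {i b : ℕ} (hi : i < L * nI)
    (hb : ∀ u ∈ unknownHelpers K (finProdFinEquiv.symm ⟨i, hi⟩) (firstNodes L nI i hi.le),
      (finProdFinEquiv u : ℕ) < b) :
    (unknownHelpers K (finProdFinEquiv.symm ⟨i, hi⟩) (firstNodes L nI i hi.le)).card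
      ≤ b - (i + 1) := by
  rw [← Nat.sub_sub, Nat.sub_right_comm, Nat.sub_right_comm, ← Nat.card_Ioo]
  exact Finset.card_le_card_of_injOn (fun u => (finProdFinEquiv u : ℕ))
    (fun u hu => Finset.mem_coe.2 (Finset.mem_Ioo.2 ⟨lt_of_mem_unknownHelpers hi hu, hb u hu⟩))
    (Fin.val_injective.comp finProdFinEquiv.injective).injOn

/-- Ignoring the overheard packets costs nothing once all compromised clusters precede node `i`:
their nodes are already in the list. -/
theorem card_unknownHelpers_le (K : Finset (Fin L)) {i : ℕ} (hi : i < L * nI) :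
    (unknownHelpers K (finProdFinEquiv.symm ⟨i, hi⟩) (firstNodes L nI i hi.le)).card
      ≤ L * nI - (i + 1) :=
  card_unknownHelpers_le_of_forall_lt hi fun u _ => (finProdFinEquiv u).isLt

/-- Every packet entering from another cluster is read, and the numbers in cluster `i / nI` end
before `nI * (i / nI) + nI`. -/
theorem card_unknownHelpers_le_of_mem {K : Finset (Fin L)} {i : ℕ} (hi : i < L * nI)
    (hK : (finProdFinEquiv.symm ⟨i, hi⟩ : Node L nI).1 ∈ K) :
    (unknownHelpers K (finProdFinEquiv.symm ⟨i, hi⟩) (firstNodes L nI i hi.le)).card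
      ≤ nI - (i % nI + 1) := by
  refine (card_unknownHelpers_le_of_forall_lt (b := nI * (i / nI) + nI) hi fun u hu => ?_).trans ?_
  · simp only [unknownHelpers, Finset.mem_filter_univ] at hu
    have h1 : u.1 = (finProdFinEquiv.symm ⟨i, hi⟩ : Node L nI).1 :=
      not_not.1 fun h => hu.2.2 ⟨h, Or.inr hK⟩
    have h2 : (u.1 : ℕ) = i / nI := by rw [h1]; rfl
    have h3 : (finProdFinEquiv u : ℕ) = u.2 + nI * u.1 := rfl
    have := u.2.isLt
    rw [h3, h2]
    omega
  · have := Nat.div_add_mod i nI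
    omega

/-- The clusters with the numbers below `Lc`. -/
def firstClusters (L Lc : ℕ) : Finset (Fin L) := {c | (c : ℕ) < Lc}

theorem card_firstClusters {Lc : ℕ} (h : Lc ≤ L) : (firstClusters L Lc).card = Lc := by
  rw [firstClusters, Fin.card_filter_val_lt, min_eq_right h]

theorem historyCost_firstNodes_le {Lc : ℕ} {α β : ℝ} (hβ : 0 ≤ β) (k : ℕ) (hk : k ≤ L * nI) :
    historyCost (firstClusters L Lc) α β (firstNodes L nI k hk) ≤
      ∑ i ∈ Finset.range k, min
        ((if i < nI * Lc then (nI : ℝ) - ((i % nI : ℕ) + 1) else (L * nI : ℕ) - ((i : ℝ) + 1)) * β)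
        α := by
  induction k with
  | zero => simp [firstNodes, historyCost]
  | succ i ih =>
    rw [firstNodes, historyCost, Finset.sum_range_succ]
    refine add_le_add (ih _) (min_le_min_right _ (mul_le_mul_of_nonneg_right ?_ hβ))
    have hi : i < L * nI := hk
    have hnI : 0 < nI := Nat.pos_of_mul_pos_left (i.zero_le.trans_lt hi)
    split_ifs with h
    · have hK : (finProdFinEquiv.symm ⟨i, hi⟩ : Node L nI).1 ∈ firstClusters L Lc := by
        simp only [firstClusters, Finset.mem_filter_univ]
        exact Nat.div_lt_of_lt_mul h
      have := card_unknownHelpers_le_of_mem hi hK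
      -- Ensures that real and truncated subtraction agree.
      have h2 := Nat.mod_lt i hnI
      rw [← Nat.cast_add_one, ← Nat.cast_sub h2]
      exact_mod_cast this
    · rw [← Nat.cast_add_one, ← Nat.cast_sub hk]
      exact_mod_cast card_unknownHelpers_le _ hi

end Order

/-! ### Summation over clusters and conclusion -/

theorem sum_range_mul_mod {M : Type*} [Semiring M] (g : ℕ → M) (m a r : ℕ) (hr : r ≤ m) :
    ∑ i ∈ Finset.range (m * a + r), g (i % m)
      = a * ∑ i ∈ Finset.range m, g i + ∑ i ∈ Finset.range r, g i := by
  have hmod (b s : ℕ) (hs : s ≤ m) :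
      ∑ i ∈ Finset.range s, g ((m * b + i) % m) = ∑ i ∈ Finset.range s, g i := by
    refine Finset.sum_congr rfl fun i hi => ?_
    rw [Nat.mul_add_mod, Nat.mod_eq_of_lt ((Finset.mem_range.1 hi).trans_le hs)]
  rw [Finset.sum_range_add, hmod a r hr]
  congr 1
  induction a with
  | zero => simp
  | succ a ih => rw [mul_add_one, Finset.sum_range_add, hmod a m le_rfl, ih, Nat.cast_succ,
      add_one_mul]

theorem sum_Icc_add_one {M : Type*} [AddCommMonoid M] (f : ℕ → M) (a b : ℕ) :
    ∑ i ∈ Finset.Icc (a + 1) b, f i = ∑ i ∈ Finset.Ico a b, f (i + 1) := by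
  rw [Finset.sum_Ico_add' f a b 1]
  rfl

end ClusteredDSS

open ClusteredDSS

theorem theorem1 (n L nI k Lc : ℕ) (α γ β : ℝ)
    (hn : n = L * nI) (hk : k < n) (hLc : Lc ≤ L) (hα : 0 ≤ α) (hγ : 0 ≤ γ)
    (hβ : β = γ / ((n : ℝ) - 1)) :
    ClusteredDSS.secrecyCapacity L nI k Lc α γ ≤
      ((if nI * Lc < k then
          (Lc : ℝ) * ∑ i ∈ Finset.Icc 1 nI, min (((nI : ℝ) - i) * β) α
            + ∑ i ∈ Finset.Icc (nI * Lc + 1) k, min (((n : ℝ) - i) * β) α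
        else
          ((k / nI : ℕ) : ℝ) * ∑ i ∈ Finset.Icc 1 nI, min (((nI : ℝ) - i) * β) α
            + ∑ i ∈ Finset.Icc 1 (k % nI), min (((nI : ℝ) - i) * β) α : ℝ) : EReal) := by
  subst hn
  have hβ0 : 0 ≤ β := by
    have : (1 : ℝ) ≤ (L * nI : ℕ) := by exact_mod_cast Nat.one_le_of_lt hk
    rw [hβ]
    -- For n = 1 the denominator vanishes and division by zero gives β = 0.
    exact div_nonneg hγ (by linarith)
  refine sSup_le ?_
  rintro _ ⟨C, hfit, hrel, hsec, rfl⟩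
  rw [← hβ] at hfit
  rw [EReal.coe_le_coe_iff]
  refine (C.rate_le_historyCost hfit hα hβ0 hrel hsec (card_firstClusters hLc)
    (nodup_firstNodes k hk.le) (length_firstNodes k hk.le)).trans
    ((historyCost_firstNodes_le hβ0 k hk.le).trans_eq ?_)
  -- Nodes are numbered from 0, the terms of the bound from 1.
  set g : ℕ → ℝ := fun i => min (((nI : ℝ) - (i + 1)) * β) α with hg
  have hgI (b : ℕ) : ∑ i ∈ Finset.Icc 1 b, min (((nI : ℝ) - i) * β) α
      = ∑ i ∈ Finset.range b, g i := by
    rw [← zero_add 1, sum_Icc_add_one, Finset.range_eq_Ico]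
    simp only [hg, Nat.cast_add, Nat.cast_one]
  rw [hgI, hgI]
  split_ifs with h
  · rw [sum_Icc_add_one, ← Finset.sum_range_add_sum_Ico _ h.le]
    congr 1
    · have := sum_range_mul_mod g nI Lc 0 (Nat.zero_le _)
      rw [add_zero, Finset.sum_range_zero, add_zero] at this
      rw [← this]
      exact Finset.sum_congr rfl fun i hi => by rw [if_pos (Finset.mem_range.1 hi)]
    · refine Finset.sum_congr rfl fun i hi => ?_
      rw [if_neg (Finset.mem_Ico.1 hi).1.not_gt, Nat.cast_add_one]
  -- Here all k failures lie in compromised clusters: `k / nI` full ones and a partial one.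
  · have hnI : 0 < nI := Nat.pos_of_mul_pos_left (k.zero_le.trans_lt hk)
    rw [← sum_range_mul_mod g nI (k / nI) (k % nI) (Nat.mod_lt k hnI).le, Nat.div_add_mod]
    exact Finset.sum_congr rfl fun i hi => by
      rw [if_pos ((Finset.mem_range.1 hi).trans_le (not_lt.1 h))]
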